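/- Let $\mathcal X,\mathcal Y,\mathcal Z$ be finite or countably infinite sets and, for each $n\ge 1$, let $d_1^{(n)}:\mathcal X^n\times\mathcal Y^n\to[0,\infty)$ and $d_2^{(n)}:\mathcal X^n\times\mathcal Z^n\to[0,\infty)$ be arbitrary distortion measures. A general source $\mathbf X=\{X^n\}_{n\ge1}$ is a sequence of random variables $X^n$ with values in $\mathcal X^n$ (no consistency is required between different $n$). A code of blocklength $n$ consists of integers $M_1^{(n)},M_2^{(n)}\ge1$, encoders $f_i^{(n)}:\mathcal X^n\to\{1,\dots,M_i^{(n)}\}$ $(i=1,2)$, and decoders $\varphi_1^{(n)}:\{1,\dots,M_1^{(n)}\}\to\mathcal Y^n$ and $\varphi_2^{(n)}:\{1,\dots,M_1^{(n)}\}\times\{1,\dots,M_2^{(n)}\}\to\mathcal Z^n$. For real random variables $S_n$ put $$\operatorname{p-}\!\limsup_{n\to\infty}S_n=\inf\{a\in\mathbb R:\lim_{n\to\infty}\Pr\{S_n>a\}=0\}\in[-\infty,+\infty].$$ For real numbers $D_1,D_2\ge0$, with $D=(D_1,D_2)$, the rate-distortion region $\mathcal R(D|\mathbf X)$ is the set of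 all $(R_1,R_2)\in[0,\infty)^2$ for which there is a sequence of codes, one for each blocklength $n$, such that $$\operatorname{p-}\!\limsup_{n\to\infty}d_1^{(n)}\bigl(X^n,\varphi_1^{(n)}(f_1^{(n)}(X^n))\bigr)\le D_1,\qquad \operatorname{p-}\!\limsup_{n\to\infty}d_2^{(n)}\bigl(X^n,\varphi_2^{(n)}(f_1^{(n)}(X^n),f_2^{(n)}(X^n))\bigr)\le D_2,$$ $$\limsup_{n\to\infty}\frac1n\log M_i^{(n)}\le R_i\quad(i=1,2).$$ **Theorem (mixed sources).** Let $\mathbf X_1=\{X_1^n\}$ and $\mathbf X_2=\{X_2^n\}$ be general sources over $\mathcal X$, let $\alpha_1,\alpha_2>0$ with $\alpha_1+\alpha_2=1$, and let $\mathbf X=\{X^n\}$ be the mixed source, i.e. $P_{X^n}(x^n)=\alpha_1P_{X_1^n}(x^n)+\alpha_2P_{X_2^n}(x^n)$ for all $n\ge 1$ and all $x^n\in\mathcal X^n$. Then, for all real numbers $D_1,D_2\ge0$, $$\mathcal R(D|\mathbf X)=\mathcal R(D|\mathbf X_1)\cap\mathcal R(D|\mathbf X_2).$$ -/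

import Mathlib

open Filter Topology
open scoped NNReal ENNReal

namespace SuccessiveRefinement

/-- A general source over the alphabet `X`: for each blocklength `n`, the probability distribution
of the source sequence `X^n` on the `n`-fold product `Fin n → X`. No consistency between different
blocklengths is required. (The entry `n = 0` is the unique distribution on a one-point set and has
no effect on any limit.) -/
abbrev GeneralSource (X : Type*) : Type _ := (n : ℕ) → PMF (Fin n → X)

/-- The limit superior in probability `inf {a ∈ ℝ : lim Pr {S_n > a} = 0}` of a sequence of
real-valued random variables `S n`, defined on discrete probability spaces `(A n, P n)`. It is an
extended real number; the infimum of the empty set is `+∞`. -/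
noncomputable def pLimsup {A : ℕ → Type*} (P : (n : ℕ) → PMF (A n)) (S : (n : ℕ) → A n → ℝ) :
    EReal :=
  sInf {b : EReal | ∃ a : ℝ, b = (a : EReal) ∧
    Tendsto (fun n => (P n).toOuterMeasure {x | a < S n x}) atTop (𝓝 0)}

/-- A code for source space `A` and reconstruction spaces `B`, `C`: the numbers of codewords
`M₁, M₂ ≥ 1`, two encoders and two decoders; the second decoder sees both codewords. -/
structure Code (A B C : Type*) where
  M₁ : ℕ
  M₂ : ℕ
  M₁_pos : 0 < M₁
  M₂_pos : 0 < M₂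
  f₁ : A → Fin M₁
  f₂ : A → Fin M₂
  φ₁ : Fin M₁ → B
  φ₂ : Fin M₁ → Fin M₂ → C

/-- The first reconstruction `φ₁ (f₁ x)`. -/
def Code.rec₁ {A B C : Type*} (c : Code A B C) (x : A) : B := c.φ₁ (c.f₁ x)

/-- The second reconstruction `φ₂ (f₁ x, f₂ x)`. -/
def Code.rec₂ {A B C : Type*} (c : Code A B C) (x : A) : C := c.φ₂ (c.f₁ x) (c.f₂ x)

/-- The rate `(1 / n) log M` in nats. -/
noncomputable def rate (n M : ℕ) : ℝ := (1 / (n : ℝ)) * Real.log (M : ℝ)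

/-- `(R, D)` is achievable for the source `P` under the maximum-distortion criterion. The upper
limits of the rates are taken in the extended reals, so that they may be `+∞`. -/
def FmAchievable {X Y Z : Type*}
    (d₁ : (n : ℕ) → (Fin n → X) → (Fin n → Y) → ℝ≥0)
    (d₂ : (n : ℕ) → (Fin n → X) → (Fin n → Z) → ℝ≥0)
    (P : GeneralSource X) (R₁ R₂ D₁ D₂ : ℝ) : Prop :=
  ∃ c : (n : ℕ) → Code (Fin n → X) (Fin n → Y) (Fin n → Z),
    pLimsup P (fun n x => (d₁ n x ((c n).rec₁ x) : ℝ)) ≤ (D₁ : EReal) ∧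
    pLimsup P (fun n x => (d₂ n x ((c n).rec₂ x) : ℝ)) ≤ (D₂ : EReal) ∧
    limsup (fun n => ((rate n (c n).M₁ : ℝ) : EReal)) atTop ≤ (R₁ : EReal) ∧
    limsup (fun n => ((rate n (c n).M₂ : ℝ) : EReal)) atTop ≤ (R₂ : EReal)

/-- The rate-distortion region `R(D | X)`: all pairs of nonnegative rates that are achievable at
the distortion levels `D₁, D₂`. -/
def rateDistortionRegion {X Y Z : Type*}
    (d₁ : (n : ℕ) → (Fin n → X) → (Fin n → Y) → ℝ≥0)
    (d₂ : (n : ℕ) → (Fin n → X) → (Fin n → Z) → ℝ≥0)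
    (D₁ D₂ : ℝ) (P : GeneralSource X) : Set (ℝ × ℝ) :=
  {R | 0 ≤ R.1 ∧ 0 ≤ R.2 ∧ FmAchievable d₁ d₂ P R.1 R.2 D₁ D₂}

/-- `P` is the mixed source with components `P₁`, `P₂` and weights `α₁`, `α₂`. -/
def IsMixedSource {X : Type*} (α₁ α₂ : ℝ≥0) (P₁ P₂ P : GeneralSource X) : Prop :=
  ∀ (n : ℕ) (x : Fin n → X), P n x = (α₁ : ℝ≥0∞) * P₁ n x + (α₂ : ℝ≥0∞) * P₂ n x

end SuccessiveRefinement

/-!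
The mixed source satisfies `P(A) = α₁ P₁(A) + α₂ P₂(A)` for every event `A`, with positive weights,
so a sequence of events has vanishing probability under `P` if and only if it has vanishing
probability under both `P₁` and `P₂` (`tendsto_mixed_iff`). Consequently a sequence of codes that
works for `P` works for both components.

Conversely, let `c` and `c'` be codes for the two components. For a source word `x` consider the
excess distortion `max (d₁ - D₁) (d₂ - D₂)` of each of the two codes. The merged code
(`Code.merge`) encodes `x` with the code of smaller excess, and the first codeword also tells which
code was chosen. The second decoder sees the first codeword, hence knows the choice as well. The
merged code has `M₁ + M₁'` and `max M₂ M₂'` codewords; the flag costs at most `log 2 / n` in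
rate, which vanishes. The excess of the merged code is the minimum of the two excesses, so it
exceeds `γ > 0` only where both codes fail, an event which has vanishing probability under either
component.
-/

namespace SuccessiveRefinement

/-! ### Upper limits in probability and mixtures -/

/-- The bound `pLimsup P S ≤ D` says that all exceedance events above `D` have vanishing
probability. -/
lemma pLimsup_le_coe_iff {A : ℕ → Type*} (P : (n : ℕ) → PMF (A n)) (S : (n : ℕ) → A n → ℝ)
    (D : ℝ) :
    pLimsup P S ≤ (D : EReal) ↔
      ∀ γ : ℝ, D < γ → Tendsto (fun n => (P n).toOuterMeasure {x | γ < S n x}) atTop (𝓝 0) := by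
  constructor
  · intro h γ hγ
    obtain ⟨b, ⟨a, rfl, ha⟩, hb⟩ := sInf_lt_iff.1 (h.trans_lt (EReal.coe_lt_coe_iff.2 hγ))
    refine tendsto_of_tendsto_of_tendsto_of_le_of_le tendsto_const_nhds ha
      (fun _ => zero_le) fun n => MeasureTheory.measure_mono fun x hx => ?_
    exact (EReal.coe_lt_coe_iff.1 hb).trans hx
  · intro h
    refine EReal.le_of_forall_lt_iff_le.1 fun γ hγ => ?_
    exact sInf_le ⟨γ, rfl, h γ (EReal.coe_lt_coe_iff.1 hγ)⟩

/-- The mixture identity extends from points to events. -/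
lemma IsMixedSource.toOuterMeasure_eq {X : Type*} {α₁ α₂ : ℝ≥0} {P₁ P₂ P : GeneralSource X}
    (hP : IsMixedSource α₁ α₂ P₁ P₂ P) (n : ℕ) (s : Set (Fin n → X)) :
    (P n).toOuterMeasure s =
      α₁ * (P₁ n).toOuterMeasure s + α₂ * (P₂ n).toOuterMeasure s := by
  simp only [PMF.toOuterMeasure_apply, ← ENNReal.tsum_mul_left, ← ENNReal.tsum_add]
  refine tsum_congr fun x => ?_
  by_cases hx : x ∈ s <;> simp [hx, hP n x]

lemma tendsto_zero_of_const_mul_le {u v : ℕ → ℝ≥0∞} {α : ℝ≥0} (hα : 0 < α)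
    (h : ∀ n, α * u n ≤ v n) (hv : Tendsto v atTop (𝓝 0)) : Tendsto u atTop (𝓝 0) := by
  have hα' : (α : ℝ≥0∞) ≠ 0 := by exact_mod_cast hα.ne'
  have hlim : Tendsto (fun n => (α : ℝ≥0∞)⁻¹ * v n) atTop (𝓝 0) := by
    simpa using ENNReal.Tendsto.const_mul hv (Or.inr (ENNReal.inv_ne_top.2 hα'))
  refine tendsto_of_tendsto_of_tendsto_of_le_of_le tendsto_const_nhds hlim
    (fun _ => zero_le) fun n => ?_
  calc u n = (α : ℝ≥0∞)⁻¹ * (α * u n) := by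
        rw [← mul_assoc, ENNReal.inv_mul_cancel hα' ENNReal.coe_ne_top, one_mul]
    _ ≤ (α : ℝ≥0∞)⁻¹ * v n := by gcongr; exact h n

lemma IsMixedSource.tendsto_mixed_iff {X : Type*} {α₁ α₂ : ℝ≥0} (hα₁ : 0 < α₁) (hα₂ : 0 < α₂)
    {P₁ P₂ P : GeneralSource X} (hP : IsMixedSource α₁ α₂ P₁ P₂ P)
    (s : (n : ℕ) → Set (Fin n → X)) :
    Tendsto (fun n => (P n).toOuterMeasure (s n)) atTop (𝓝 0) ↔
      Tendsto (fun n => (P₁ n).toOuterMeasure (s n)) atTop (𝓝 0) ∧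
        Tendsto (fun n => (P₂ n).toOuterMeasure (s n)) atTop (𝓝 0) := by
  simp only [hP.toOuterMeasure_eq]
  refine ⟨fun h => ⟨tendsto_zero_of_const_mul_le hα₁ (fun n => le_self_add) h,
    tendsto_zero_of_const_mul_le hα₂ (fun n => le_add_self) h⟩, fun ⟨h₁, h₂⟩ => ?_⟩
  simpa using (ENNReal.Tendsto.const_mul h₁ (Or.inr (ENNReal.coe_ne_top (r := α₁)))).add
    (ENNReal.Tendsto.const_mul h₂ (Or.inr (ENNReal.coe_ne_top (r := α₂))))

lemma IsMixedSource.pLimsup_le_iff {X : Type*} {α₁ α₂ : ℝ≥0} (hα₁ : 0 < α₁) (hα₂ : 0 < α₂)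
    {P₁ P₂ P : GeneralSource X} (hP : IsMixedSource α₁ α₂ P₁ P₂ P)
    (S : (n : ℕ) → (Fin n → X) → ℝ) (D : ℝ) :
    pLimsup P S ≤ (D : EReal) ↔ pLimsup P₁ S ≤ (D : EReal) ∧ pLimsup P₂ S ≤ (D : EReal) := by
  simp only [pLimsup_le_coe_iff, hP.tendsto_mixed_iff hα₁ hα₂, forall_and]

/-! ### Merging two codes -/

open Classical in
/-- The code that encodes a source word in `s` with `c` and any other source word with `c'`. The
first codeword reveals which of the two was used: its index set is the disjoint union of those of
`c` and `c'`. The second index set is the larger of the two; the decoder reduces the index modulo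
`M₂`, which does nothing to the indices that actually occur. -/
noncomputable def Code.merge {A B C : Type*} (s : Set A) (c c' : Code A B C) : Code A B C where
  M₁ := c.M₁ + c'.M₁
  M₂ := max c.M₂ c'.M₂
  M₁_pos := Nat.add_pos_left c.M₁_pos _
  M₂_pos := lt_max_of_lt_left c.M₂_pos
  f₁ x := if x ∈ s then finSumFinEquiv (Sum.inl (c.f₁ x)) else finSumFinEquiv (Sum.inr (c'.f₁ x))
  f₂ x := if x ∈ s then (c.f₂ x).castLE (le_max_left _ _) else (c'.f₂ x).castLE (le_max_right _ _)
  φ₁ i := (finSumFinEquiv.symm i).elim c.φ₁ c'.φ₁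
  φ₂ i j := (finSumFinEquiv.symm i).elim
    (fun i => c.φ₂ i ⟨j % c.M₂, Nat.mod_lt _ c.M₂_pos⟩)
    (fun i => c'.φ₂ i ⟨j % c'.M₂, Nat.mod_lt _ c'.M₂_pos⟩)

section merge

variable {A B C : Type*} {s : Set A} (c c' : Code A B C) {x : A}

lemma Code.merge_rec₁_of_mem (hx : x ∈ s) : (c.merge s c').rec₁ x = c.rec₁ x := by
  simp only [Code.rec₁, Code.merge, if_pos hx, Equiv.symm_apply_apply, Sum.elim_inl]

lemma Code.merge_rec₁_of_notMem (hx : x ∉ s) : (c.merge s c').rec₁ x = c'.rec₁ x := by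
  simp only [Code.rec₁, Code.merge, if_neg hx, Equiv.symm_apply_apply, Sum.elim_inr]

lemma Code.merge_rec₂_of_mem (hx : x ∈ s) : (c.merge s c').rec₂ x = c.rec₂ x := by
  simp only [Code.rec₂, Code.merge, if_pos hx, Equiv.symm_apply_apply, Sum.elim_inl,
    Fin.val_castLE, Nat.mod_eq_of_lt (c.f₂ x).isLt]

lemma Code.merge_rec₂_of_notMem (hx : x ∉ s) : (c.merge s c').rec₂ x = c'.rec₂ x := by
  simp only [Code.rec₂, Code.merge, if_neg hx, Equiv.symm_apply_apply, Sum.elim_inr,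
    Fin.val_castLE, Nat.mod_eq_of_lt (c'.f₂ x).isLt]

end merge

/-- The amount by which the code `c` misses the distortion levels `D₁`, `D₂` at `x`: the larger of
the two differences between distortion and level. -/
noncomputable def Code.excess {A B C : Type*} (δ₁ : A → B → ℝ≥0) (δ₂ : A → C → ℝ≥0) (D₁ D₂ : ℝ)
    (c : Code A B C) (x : A) : ℝ :=
  max (δ₁ x (c.rec₁ x) - D₁) (δ₂ x (c.rec₂ x) - D₂)

lemma Code.excess_merge {A B C : Type*} (δ₁ : A → B → ℝ≥0) (δ₂ : A → C → ℝ≥0) (D₁ D₂ : ℝ)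
    (c c' : Code A B C) (x : A) :
    (c.merge {x | c.excess δ₁ δ₂ D₁ D₂ x ≤ c'.excess δ₁ δ₂ D₁ D₂ x} c').excess δ₁ δ₂ D₁ D₂ x =
      min (c.excess δ₁ δ₂ D₁ D₂ x) (c'.excess δ₁ δ₂ D₁ D₂ x) := by
  set s := {x | c.excess δ₁ δ₂ D₁ D₂ x ≤ c'.excess δ₁ δ₂ D₁ D₂ x} with hs
  by_cases hx : x ∈ s
  · rw [min_eq_left hx, Code.excess, Code.merge_rec₁_of_mem _ _ hx, Code.merge_rec₂_of_mem _ _ hx,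
      Code.excess]
  · rw [min_eq_right (not_le.1 hx).le, Code.excess, Code.merge_rec₁_of_notMem _ _ hx,
      Code.merge_rec₂_of_notMem _ _ hx, Code.excess]

/-- The two distortion constraints together say that the excess is asymptotically at most `0`. -/
lemma pLimsup_excess_le_zero_iff {A B C : ℕ → Type*} (δ₁ : (n : ℕ) → A n → B n → ℝ≥0)
    (δ₂ : (n : ℕ) → A n → C n → ℝ≥0) (D₁ D₂ : ℝ) (P : (n : ℕ) → PMF (A n))
    (c : (n : ℕ) → Code (A n) (B n) (C n)) :
    pLimsup P (fun n => (c n).excess (δ₁ n) (δ₂ n) D₁ D₂) ≤ ((0 : ℝ) : EReal) ↔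
      pLimsup P (fun n x => (δ₁ n x ((c n).rec₁ x) : ℝ)) ≤ (D₁ : EReal) ∧
        pLimsup P (fun n x => (δ₂ n x ((c n).rec₂ x) : ℝ)) ≤ (D₂ : EReal) := by
  simp only [pLimsup_le_coe_iff]
  constructor
  · intro h
    refine ⟨fun γ hγ => ?_, fun γ hγ => ?_⟩
    · refine tendsto_of_tendsto_of_tendsto_of_le_of_le tendsto_const_nhds
        (h (γ - D₁) (sub_pos.2 hγ)) (fun _ => zero_le) fun n =>
          MeasureTheory.measure_mono fun x hx => ?_
      exact lt_max_of_lt_left (sub_lt_sub_right hx D₁)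
    · refine tendsto_of_tendsto_of_tendsto_of_le_of_le tendsto_const_nhds
        (h (γ - D₂) (sub_pos.2 hγ)) (fun _ => zero_le) fun n =>
          MeasureTheory.measure_mono fun x hx => ?_
      exact lt_max_of_lt_right (sub_lt_sub_right hx D₂)
  · rintro ⟨h₁, h₂⟩ γ hγ
    have h := (h₁ (D₁ + γ) (lt_add_of_pos_right _ hγ)).add
      (h₂ (D₂ + γ) (lt_add_of_pos_right _ hγ))
    rw [add_zero] at h
    refine tendsto_of_tendsto_of_tendsto_of_le_of_le tendsto_const_nhds h
      (fun _ => zero_le) fun n => (MeasureTheory.measure_mono fun x hx => ?_).trans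
        (MeasureTheory.measure_union_le _ _)
    rcases lt_max_iff.1 (show γ < max _ _ from hx) with hx | hx
    · exact Or.inl (lt_sub_iff_add_lt'.1 hx)
    · exact Or.inr (lt_sub_iff_add_lt'.1 hx)

/-! ### Rates -/

lemma rate_mono (n : ℕ) {M M' : ℕ} (hM : 0 < M) (h : M ≤ M') : rate n M ≤ rate n M' := by
  unfold rate
  gcongr

lemma rate_max (n : ℕ) {M M' : ℕ} (hM : 0 < M) (hM' : 0 < M') :
    rate n (max M M') = max (rate n M) (rate n M') := by
  rcases le_total M M' with h | h
  · rw [max_eq_right h, max_eq_right (rate_mono n hM h)]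
  · rw [max_eq_left h, max_eq_left (rate_mono n hM' h)]

lemma rate_add_le (n : ℕ) {M M' : ℕ} (hM : 0 < M) (hM' : 0 < M') :
    rate n (M + M') ≤ rate n 2 + max (rate n M) (rate n M') := by
  have hpos : 0 < max M M' := lt_max_of_lt_left hM
  calc rate n (M + M') ≤ rate n (2 * max M M') :=
        rate_mono n (by omega) (by omega)
    _ = rate n 2 + rate n (max M M') := by
        unfold rate
        rw [Nat.cast_mul, Real.log_mul (by norm_num) (by exact_mod_cast hpos.ne'), mul_add]
    _ = _ := by rw [rate_max n hM hM']

lemma tendsto_rate_const (M : ℕ) : Tendsto (fun n => rate n M) atTop (𝓝 0) := by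
  simpa [rate] using tendsto_one_div_atTop_nhds_zero_nat.mul_const (Real.log M)

lemma limsup_coe_le_coe_iff (u : ℕ → ℝ) (R : ℝ) :
    limsup (fun n => (u n : EReal)) atTop ≤ (R : EReal) ↔
      ∀ r : ℝ, R < r → ∀ᶠ n in atTop, u n < r := by
  rw [limsup_le_iff]
  constructor
  · intro h r hr
    simpa only [EReal.coe_lt_coe_iff] using h r (EReal.coe_lt_coe_iff.2 hr)
  · intro h y hy
    obtain ⟨r, hr, hry⟩ := EReal.lt_iff_exists_real_btwn.1 hy
    filter_upwards [h r (EReal.coe_lt_coe_iff.1 hr)] with n hn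
    exact (EReal.coe_lt_coe_iff.2 hn).trans hry

lemma limsup_rate_max_le {M M' : ℕ → ℕ} (hM : ∀ n, 0 < M n) (hM' : ∀ n, 0 < M' n) {R : ℝ}
    (h : limsup (fun n => (rate n (M n) : EReal)) atTop ≤ (R : EReal))
    (h' : limsup (fun n => (rate n (M' n) : EReal)) atTop ≤ (R : EReal)) :
    limsup (fun n => (rate n (max (M n) (M' n)) : EReal)) atTop ≤ (R : EReal) := by
  rw [limsup_coe_le_coe_iff] at h h' ⊢
  intro r hr
  filter_upwards [h r hr, h' r hr] with n hn hn'
  rw [rate_max n (hM n) (hM' n)]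
  exact max_lt hn hn'

lemma limsup_rate_add_le {M M' : ℕ → ℕ} (hM : ∀ n, 0 < M n) (hM' : ∀ n, 0 < M' n) {R : ℝ}
    (h : limsup (fun n => (rate n (M n) : EReal)) atTop ≤ (R : EReal))
    (h' : limsup (fun n => (rate n (M' n) : EReal)) atTop ≤ (R : EReal)) :
    limsup (fun n => (rate n (M n + M' n) : EReal)) atTop ≤ (R : EReal) := by
  rw [limsup_coe_le_coe_iff] at h h' ⊢
  intro r hr
  obtain ⟨t, hRt, htr⟩ := exists_between hr
  filter_upwards [h t hRt, h' t hRt,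
    (tendsto_rate_const 2).eventually_lt_const (sub_pos.2 htr)] with n hn hn' h2
  linarith [rate_add_le n (hM n) (hM' n), max_lt hn hn']

/-! ### Achievability for mixed sources -/

lemma IsMixedSource.fmAchievable_iff {X Y Z : Type*}
    (d₁ : (n : ℕ) → (Fin n → X) → (Fin n → Y) → ℝ≥0)
    (d₂ : (n : ℕ) → (Fin n → X) → (Fin n → Z) → ℝ≥0)
    {α₁ α₂ : ℝ≥0} (hα₁ : 0 < α₁) (hα₂ : 0 < α₂) {P₁ P₂ P : GeneralSource X}
    (hP : IsMixedSource α₁ α₂ P₁ P₂ P) (R₁ R₂ D₁ D₂ : ℝ) :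
    FmAchievable d₁ d₂ P R₁ R₂ D₁ D₂ ↔
      FmAchievable d₁ d₂ P₁ R₁ R₂ D₁ D₂ ∧ FmAchievable d₁ d₂ P₂ R₁ R₂ D₁ D₂ := by
  constructor
  · rintro ⟨c, h₁, h₂, hR₁, hR₂⟩
    rw [hP.pLimsup_le_iff hα₁ hα₂] at h₁ h₂
    exact ⟨⟨c, h₁.1, h₂.1, hR₁, hR₂⟩, ⟨c, h₁.2, h₂.2, hR₁, hR₂⟩⟩
  · rintro ⟨⟨c, h₁, h₂, hR₁, hR₂⟩, ⟨c', h₁', h₂', hR₁', hR₂'⟩⟩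
    have he := (pLimsup_excess_le_zero_iff d₁ d₂ D₁ D₂ P₁ c).2 ⟨h₁, h₂⟩
    have he' := (pLimsup_excess_le_zero_iff d₁ d₂ D₁ D₂ P₂ c').2 ⟨h₁', h₂'⟩
    let m : (n : ℕ) → Code (Fin n → X) (Fin n → Y) (Fin n → Z) := fun n =>
      (c n).merge {x | (c n).excess (d₁ n) (d₂ n) D₁ D₂ x ≤ (c' n).excess (d₁ n) (d₂ n) D₁ D₂ x}
        (c' n)
    have hm : pLimsup P (fun n => (m n).excess (d₁ n) (d₂ n) D₁ D₂) ≤ ((0 : ℝ) : EReal) := by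
      rw [hP.pLimsup_le_iff hα₁ hα₂]
      rw [pLimsup_le_coe_iff] at he he' ⊢
      rw [pLimsup_le_coe_iff]
      refine ⟨fun γ hγ => ?_, fun γ hγ => ?_⟩
      · refine tendsto_of_tendsto_of_tendsto_of_le_of_le tendsto_const_nhds (he γ hγ)
          (fun _ => zero_le) fun n => MeasureTheory.measure_mono fun x hx => ?_
        exact (lt_min_iff.1 (hx.trans_eq (Code.excess_merge _ _ _ _ _ _ _))).1
      · refine tendsto_of_tendsto_of_tendsto_of_le_of_le tendsto_const_nhds (he' γ hγ)
          (fun _ => zero_le) fun n => MeasureTheory.measure_mono fun x hx => ?_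
        exact (lt_min_iff.1 (hx.trans_eq (Code.excess_merge _ _ _ _ _ _ _))).2
    obtain ⟨hm₁, hm₂⟩ := (pLimsup_excess_le_zero_iff d₁ d₂ D₁ D₂ P m).1 hm
    exact ⟨m, hm₁, hm₂,
      limsup_rate_add_le (fun n => (c n).M₁_pos) (fun n => (c' n).M₁_pos) hR₁ hR₁',
      limsup_rate_max_le (fun n => (c n).M₂_pos) (fun n => (c' n).M₂_pos) hR₂ hR₂'⟩

end SuccessiveRefinement

theorem mainTheorem5 {X Y Z : Type*} [Countable X] [Countable Y] [Countable Z]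
    (d₁ : (n : ℕ) → (Fin n → X) → (Fin n → Y) → ℝ≥0)
    (d₂ : (n : ℕ) → (Fin n → X) → (Fin n → Z) → ℝ≥0)
    (α₁ α₂ : ℝ≥0) (hα₁ : 0 < α₁) (hα₂ : 0 < α₂) (hα : α₁ + α₂ = 1)
    (P₁ P₂ P : SuccessiveRefinement.GeneralSource X)
    (hP : SuccessiveRefinement.IsMixedSource α₁ α₂ P₁ P₂ P)
    (D₁ D₂ : ℝ) (hD₁ : 0 ≤ D₁) (hD₂ : 0 ≤ D₂) :
    SuccessiveRefinement.rateDistortionRegion d₁ d₂ D₁ D₂ P =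
      SuccessiveRefinement.rateDistortionRegion d₁ d₂ D₁ D₂ P₁ ∩
        SuccessiveRefinement.rateDistortionRegion d₁ d₂ D₁ D₂ P₂ := by
  ext R
  simp only [SuccessiveRefinement.rateDistortionRegion, Set.mem_inter_iff, Set.mem_ofPred_eq,
    hP.fmAchievable_iff d₁ d₂ hα₁ hα₂]
  tauto
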